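/- Let $G$ be a finite, undirected, simple planar graph with minimum degree $\delta(G)\ge 2$ and girth $g(G)\ge 7$, where the girth is the length of a shortest cycle. Then the independent bondage number of $G$ satisfies $b_i(G)\le 4$. Here an independent dominating set of a graph is a set of vertices that is independent and such that every vertex outside it has a neighbor in it; $\gamma_i$ denotes the minimum cardinality of an independent dominating set; and $b_i(G)$ is the minimum cardinality of a set $B\subseteq E(G)$ such that $\gamma_i(G-B)>\gamma_i(G)$. In particular, such a set $B$ with at most four edges exists. -/

import Mathlib

open SimpleGraph

namespace SimpleGraph

/-! ### Planarity

A cellular embedding of a graph in an oriented closed surface is described by its rotation system: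
the cyclic order in which the darts (edges with a direction) leave each vertex. The faces are read
off by face tracing, and the graph is planar when some rotation system embeds each of its connected
components in the sphere. -/

/-- A rotation system: for each vertex `v`, a cyclic order of all the darts that start at `v`,
given as a permutation `next` of the darts whose cycles are exactly the sets of darts with a common
starting vertex. -/
structure RotationSystem {V : Type*} (G : SimpleGraph V) where
  /-- the next dart around the same starting vertex -/
  next : Equiv.Perm G.Dart
  next_fst : ∀ d : G.Dart, (next d).fst = d.fst
  cyclic : ∀ d d' : G.Dart, d.fst = d'.fst → next.SameCycle d d'

/-- The reversal of darts, as a permutation. -/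
def dartReversal {V : Type*} (G : SimpleGraph V) : Equiv.Perm G.Dart :=
  Function.Involutive.toPerm Dart.symm (Dart.symm_involutive (G := G))

namespace RotationSystem

/-- Face tracing: traverse the dart `d = (u, v)`, then leave `v` along the dart that comes after
`(v, u)` in the rotation at `v`. -/
def faceStep {V : Type*} {G : SimpleGraph V} (R : G.RotationSystem) : Equiv.Perm G.Dart :=
  G.dartReversal.trans R.next

/-- The faces bounded by at least one edge: the cycles of face tracing. -/
def FaceCycle {V : Type*} {G : SimpleGraph V} (R : G.RotationSystem) : Type _ :=
  Quotient (Equiv.Perm.SameCycle.setoid R.faceStep)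

/-- The number of faces, each connected component being embedded in a surface of its own. An
isolated vertex lies on a sphere with exactly one face, which no dart bounds, so those faces are
counted separately. -/
noncomputable def faceCount {V : Type*} {G : SimpleGraph V} (R : G.RotationSystem) : ℕ :=
  Nat.card R.FaceCycle + Nat.card {v : V // ∀ w, ¬ G.Adj v w}

end RotationSystem

/-- A finite graph is planar if it has a rotation system that embeds every connected component in
the sphere. The surface that carries a component has Euler characteristic
`vertices - edges + faces = 2 - 2 * genus ≤ 2`, with equality only for the sphere, so all of them
are spheres if and only if the characteristics add up to twice the number of components. -/
def IsPlanar {V : Type*} [Finite V] (G : SimpleGraph V) : Prop :=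
  ∃ R : G.RotationSystem,
    Nat.card V + R.faceCount = Nat.card G.edgeSet + 2 * Nat.card G.ConnectedComponent

/-! ### Independent domination and independent bondage -/

/-- `D` is a dominating set: every vertex is in `D` or has a neighbor in `D`. -/
def IsDominatingSet {V : Type*} (G : SimpleGraph V) (D : Set V) : Prop :=
  ∀ v, v ∈ D ∨ ∃ u ∈ D, G.Adj u v

/-- The independent domination number: the least cardinality of a set of vertices that is both
independent and dominating. -/
noncomputable def indepDominationNumber {V : Type*} (G : SimpleGraph V) : ℕ∞ :=
  ⨅ (D : Set V) (_ : G.IsIndepSet D) (_ : G.IsDominatingSet D), D.encard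

/-- The independent bondage number: the least cardinality of a set of edges whose deletion strictly
increases the independent domination number (`⊤` if there is no such set). -/
noncomputable def indepBondageNumber {V : Type*} (G : SimpleGraph V) : ℕ∞ :=
  ⨅ (B : Set (Sym2 V)) (_ : B ⊆ G.edgeSet)
    (_ : G.indepDominationNumber < (G.deleteEdges B).indepDominationNumber), B.encard

end SimpleGraph

/-! Since faces have length at least 7, Euler's formula gives `5E < 7V`, so the charges `5 d(v) -
14` have negative sum. Let every vertex give 2 to each neighbor of degree 2. If every edge had
weight at least 6 and every vertex of degree 4 a neighbor of degree at least 3, no final charge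
would be negative (`exists_light_configuration`). So one of two configurations occurs, and each
yields at most four edges whose deletion forces any independent dominating set `D` to be wasteful:
it can be traded for a smaller one of `G`. At an edge `uv` of weight at most 5, delete all edges
meeting `u` or `v`; both enter `D`, and one or both can be dropped. At a vertex `v` of degree 4 with
neighbors of degree 2, isolate one neighbor and make two others pendant at `v`. If `v` is in `D`,
the isolated neighbor is redundant; otherwise three neighbors of `v` lie in `D`, and at most two
vertices replace them. -/

namespace SimpleGraph

/-! ### Closed non-backtracking walks and girth -/

section Girth

variable {V : Type*} {G : SimpleGraph V}

/-- A sequence of successively adjacent vertices gives walks. -/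
theorem exists_walk_of_adj_succ {f : ℕ → V} (hf : ∀ n, G.Adj (f n) (f (n + 1))) (n : ℕ) :
    ∀ i j : ℕ, j = i + n → ∃ p : G.Walk (f i) (f j), p.length = n ∧
      p.support = (List.range' i (n + 1)).map f ∧
      p.edges = (List.range' i n).map fun m => s(f m, f (m + 1)) := by
  induction n with
  | zero =>
    rintro i j rfl
    exact ⟨Walk.nil, by simp⟩
  | succ n ih =>
    intro i j hj
    obtain ⟨p, h1, h2, h3⟩ := ih (i + 1) j (by omega)
    refine ⟨Walk.cons (hf i) p, by simp [h1], ?_, ?_⟩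
    · rw [Walk.support_cons, h2, List.range'_succ (n := n + 1), List.map_cons]
    · rw [Walk.edges_cons, h3, List.range'_succ, List.map_cons]

/-- A non-backtracking sequence of successively adjacent vertices repeats a vertex only after at
least as many steps as the girth. -/
theorem egirth_le_of_nonbacktracking {f : ℕ → V} (hf : ∀ n, G.Adj (f n) (f (n + 1)))
    (hb : ∀ n, f (n + 2) ≠ f n) {k : ℕ} (hk : 0 < k) (h0 : f k = f 0) : G.egirth ≤ k := by
  classical
  -- The least gap `l` between two equal terms bounds a stretch without repetition, which closes up
  -- to a cycle.
  have hex : ∃ l, 0 < l ∧ ∃ i, i + l ≤ k ∧ f (i + l) = f i := ⟨k, hk, 0, by simp, by simpa using h0⟩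
  obtain ⟨hl, i, hik, hfi⟩ := Nat.find_spec hex
  have hmin := fun m hm => Nat.find_min (m := m) hex hm
  set l := Nat.find hex
  have hl1 : l ≠ 1 := fun h => (hf i).ne (by rw [← hfi, h])
  have hl2 : l ≠ 2 := fun h => hb i (by rw [← hfi, h])
  have hinj' : ∀ a b, i + 1 ≤ a → a < b → b ≤ i + l → f a ≠ f b := by
    intro a b ha hab hbl h
    exact hmin (b - a) (by omega) ⟨by omega, a, by omega, by rw [Nat.add_sub_cancel' hab.le, h]⟩
  have hinj : ∀ a b, i + 1 ≤ a → a ≤ i + l → i + 1 ≤ b → b ≤ i + l → f a = f b → a = b := by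
    intro a b ha hal hb hbl h
    rcases lt_trichotomy a b with hab | hab | hab
    · exact absurd h (hinj' a b ha hab hbl)
    · exact hab
    · exact absurd h.symm (hinj' b a hb hab hal)
  obtain ⟨p, h1, h2, h3⟩ := exists_walk_of_adj_succ hf (l - 1) (i + 1) (i + l) (by omega)
  have hp : p.IsPath := by
    refine Walk.IsPath.mk' ?_
    rw [h2]
    refine List.Nodup.map_on ?_ (List.nodup_range')
    intro a ha b hb h
    rw [List.mem_range'_1] at ha hb
    exact hinj a b ha.1 (by omega) hb.1 (by omega) h
  have hadj : G.Adj (f (i + l)) (f (i + 1)) := by rw [hfi]; exact hf i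
  have hc : (Walk.cons hadj p).IsCycle := by
    rw [Walk.cons_isCycle_iff]
    refine ⟨hp, ?_⟩
    rw [h3, List.mem_map]
    rintro ⟨m, hm, he⟩
    rw [List.mem_range'_1] at hm
    rw [Sym2.eq_iff] at he
    -- The closing edge can lie on the path only if `l = 2`, that is, after backtracking.
    rcases he with ⟨h, -⟩ | ⟨h, h'⟩
    · have := hinj m (i + l) hm.1 (by omega) (by omega) le_rfl h
      omega
    · have := hinj m (i + 1) hm.1 (by omega) le_rfl (by omega) h
      have := hinj (m + 1) (i + l) (by omega) (by omega) (by omega) le_rfl h'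
      omega
  refine (egirth_le_length hc).trans ?_
  rw [Walk.length_cons, h1]
  exact_mod_cast (by omega : l - 1 + 1 ≤ k)

end Girth

/-! ### Faces of planar graphs -/

section Faces

variable {V : Type*} {G : SimpleGraph V}

namespace RotationSystem

variable (R : G.RotationSystem)

theorem faceStep_fst (d : G.Dart) : (R.faceStep d).fst = d.snd :=
  R.next_fst d.symm

/-- Turning back would make `d.symm` a fixed point of the rotation, hence the only dart at its
vertex. -/
theorem faceStep_ne_symm [Fintype V] [DecidableRel G.Adj] (hdeg : 2 ≤ G.minDegree) (d : G.Dart) :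
    R.faceStep d ≠ d.symm := by
  intro h
  have hfix : R.next d.symm = d.symm := h
  have h2 : 1 < (G.neighborFinset d.snd).card := by
    rw [card_neighborFinset_eq_degree]
    exact hdeg.trans (G.minDegree_le_degree _)
  obtain ⟨w, hw, hne⟩ := Finset.exists_mem_ne h2 d.fst
  rw [mem_neighborFinset] at hw
  have hcyc := R.cyclic d.symm ⟨(d.snd, w), hw⟩ rfl
  have heq : d.symm = ⟨(d.snd, w), hw⟩ := hcyc.eq_of_left hfix
  exact hne (congrArg (fun e : G.Dart => e.snd) heq).symm

/-- The boundary walk of a face is at least as long as the girth. -/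
theorem egirth_le_of_faceStep_pow_eq [Fintype V] [DecidableRel G.Adj] (hdeg : 2 ≤ G.minDegree)
    (d : G.Dart) {k : ℕ} (hk : 0 < k) (h : (R.faceStep ^ k) d = d) : G.egirth ≤ k := by
  have hsucc : ∀ n, ((R.faceStep ^ (n + 1)) d).fst = ((R.faceStep ^ n) d).snd := fun n => by
    rw [pow_succ', Equiv.Perm.mul_apply, faceStep_fst]
  refine egirth_le_of_nonbacktracking (f := fun n => ((R.faceStep ^ n) d).fst) ?_ ?_ hk (by simp [h])
  · intro n
    simp only [hsucc]
    exact ((R.faceStep ^ n) d).adj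
  · intro n hn
    refine R.faceStep_ne_symm hdeg ((R.faceStep ^ n) d) ?_
    have h1 := hsucc n
    have h2 := hsucc (n + 1)
    change ((R.faceStep ^ (n + 1 + 1)) d).fst = _ at hn
    rw [h2] at hn
    rw [pow_succ', Equiv.Perm.mul_apply] at h1 hn
    exact Dart.ext _ _ (Prod.ext h1 hn)

/-- Each face contributes its first `g` darts, distinct because no boundary walk closes up sooner;
there are `2E` darts in all. -/
theorem mul_card_faceCycle_le [Fintype V] [DecidableRel G.Adj] (hdeg : 2 ≤ G.minDegree) {g : ℕ}
    (hg : g ≤ G.egirth) : g * Nat.card R.FaceCycle ≤ 2 * G.edgeFinset.card := by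
  classical
  rw [← dart_card_eq_twice_card_edges, ← Nat.card_eq_fintype_card (α := G.Dart)]
  have hlt : ∀ (d : G.Dart) (i j : ℕ), i < j → j < g →
      (R.faceStep ^ i) d ≠ (R.faceStep ^ j) d := by
    intro d i j hij hj h
    have hfix : (R.faceStep ^ (j - i)) d = d := by
      apply (R.faceStep ^ i).injective
      rw [← Equiv.Perm.mul_apply, ← pow_add, Nat.add_sub_cancel' hij.le, h]
    have := hg.trans (R.egirth_le_of_faceStep_pow_eq hdeg d (by omega) hfix)
    have : g ≤ j - i := by exact_mod_cast this
    omega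
  let F : Fin g × R.FaceCycle → G.Dart := fun x => (R.faceStep ^ (x.1 : ℕ)) (Quotient.out x.2)
  have hF : Function.Injective F := by
    rintro ⟨i, q⟩ ⟨j, q'⟩ h
    have h' : (R.faceStep ^ (i : ℕ)) (Quotient.out q) = (R.faceStep ^ (j : ℕ)) (Quotient.out q') := h
    have hq : q = q' := by
      rw [← Quotient.out_eq q, ← Quotient.out_eq q']
      refine Quotient.sound ?_
      change R.faceStep.SameCycle _ _
      rw [← Equiv.Perm.sameCycle_pow_left (n := (i : ℕ)), h', Equiv.Perm.sameCycle_pow_left]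
    subst hq
    rcases lt_trichotomy (i : ℕ) j with hij | hij | hij
    · exact absurd h' (hlt _ _ _ hij j.2)
    · rw [Fin.ext hij]
    · exact absurd h'.symm (hlt _ _ _ hij i.2)
  have := Nat.card_le_card_of_injective F hF
  rwa [Nat.card_prod, Nat.card_eq_fintype_card, Fintype.card_fin] at this

end RotationSystem

/-- Euler's formula bounds the number of edges of a planar graph of girth at least `7`. -/
theorem IsPlanar.five_mul_card_edgeFinset_lt [Fintype V] [DecidableRel G.Adj] (hG : G.IsPlanar)
    (hdeg : 2 ≤ G.minDegree) (hgirth : 7 ≤ G.egirth) :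
    5 * G.edgeFinset.card < 7 * Fintype.card V := by
  classical
  obtain ⟨R, hR⟩ := hG
  have hF := R.mul_card_faceCycle_le hdeg (g := 7) hgirth
  -- There must be a component for the strict inequality; on no vertices `minDegree` is 0 by
  -- default.
  have hV : Nonempty V := by
    by_contra h
    rw [not_nonempty_iff] at h
    simp at hdeg
  have hiso : Nat.card {v : V // ∀ w, ¬ G.Adj v w} = 0 := by
    have : IsEmpty {v : V // ∀ w, ¬ G.Adj v w} := by
      refine ⟨fun v => ?_⟩
      obtain ⟨w, hw⟩ := (G.degree_pos_iff_exists_adj v.1).1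
        (by have := G.minDegree_le_degree v.1; omega)
      exact v.2 w hw
    exact Nat.card_of_isEmpty
  have hc : 0 < Nat.card G.ConnectedComponent := Nat.card_pos
  have hE : Nat.card G.edgeSet = G.edgeFinset.card := by
    rw [Nat.card_eq_fintype_card, edgeFinset_card]
  rw [RotationSystem.faceCount, hiso, hE, Nat.card_eq_fintype_card (α := V)] at hR
  omega

end Faces

/-! ### Light configurations -/

section Discharging

variable {V : Type*} [Fintype V] {G : SimpleGraph V} [DecidableRel G.Adj]

/-- A planar graph of minimum degree at least `2` and girth at least `7` has an edge of weight at
most `5` or a vertex of degree `4` all of whose neighbors have degree `2`. -/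
theorem IsPlanar.exists_light_configuration (hG : G.IsPlanar) (hdeg : 2 ≤ G.minDegree)
    (hgirth : 7 ≤ G.egirth) :
    (∃ u v, G.Adj u v ∧ G.degree u + G.degree v ≤ 5) ∨
      ∃ v, G.degree v = 4 ∧ ∀ u, G.Adj v u → G.degree u = 2 := by
  classical
  by_contra! hcon
  obtain ⟨h1, h2⟩ := hcon
  have hE := hG.five_mul_card_edgeFinset_lt hdeg hgirth
  have hsum := G.sum_degrees_eq_twice_card_edges
  have hd : ∀ v, 2 ≤ G.degree v := fun v => hdeg.trans (G.minDegree_le_degree v)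
  -- Double counting: the number of gifts sent equals the number received.
  have hcount : ∑ v, ((G.neighborFinset v).filter fun u => G.degree u = 2).card =
      ∑ v, if G.degree v = 2 then 2 else 0 := by
    have hl : ∀ v, ((G.neighborFinset v).filter fun u => G.degree u = 2).card =
        ∑ u, if G.Adj v u ∧ G.degree u = 2 then 1 else 0 := fun v => by
      rw [Finset.sum_boole, Nat.cast_id]
      congr 1
      ext u
      simp
    simp_rw [hl]
    rw [Finset.sum_comm]
    refine Finset.sum_congr rfl fun u _ => ?_
    by_cases hu : G.degree u = 2
    · simp only [hu, and_true, if_true, Finset.sum_boole, Nat.cast_id]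
      rw [← hu, ← card_neighborFinset_eq_degree]
      congr 1
      ext w
      simp [G.adj_comm]
    · simp [hu]
  -- Final charges: 0 in degree 2, 1 in degree 3, at least `6 - 2 * 3` in degree 4, and at least `3d
  -- - 14` in degree `d ≥ 5`.
  have hv : ∀ v, 14 + 2 * ((G.neighborFinset v).filter fun u => G.degree u = 2).card ≤
      5 * G.degree v + 2 * if G.degree v = 2 then 2 else 0 := by
    intro v
    have hle : ((G.neighborFinset v).filter fun u => G.degree u = 2).card ≤ G.degree v := by
      rw [← card_neighborFinset_eq_degree]
      exact Finset.card_filter_le _ _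
    have hzero : G.degree v ≤ 3 →
        ((G.neighborFinset v).filter fun u => G.degree u = 2).card = 0 := by
      intro hv
      rw [Finset.card_eq_zero, Finset.filter_eq_empty_iff]
      intro u hu h
      have := h1 v u ((mem_neighborFinset _ _ _).1 hu)
      omega
    have hfour : G.degree v = 4 →
        ((G.neighborFinset v).filter fun u => G.degree u = 2).card < 4 := by
      intro hv
      obtain ⟨u, hu, hne⟩ := h2 v hv
      rw [← hv, ← card_neighborFinset_eq_degree]
      refine Finset.card_lt_card (Finset.filter_ssubset.2 ⟨u, ?_, hne⟩)
      simpa using hu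
    have := hd v
    split_ifs <;> omega
  have hle := Finset.sum_le_sum fun v (_ : v ∈ Finset.univ) => hv v
  rw [Finset.sum_add_distrib, Finset.sum_add_distrib, ← Finset.mul_sum, ← Finset.mul_sum,
    ← Finset.mul_sum, hcount, hsum, Finset.sum_const, Finset.card_univ, smul_eq_mul] at hle
  omega

end Discharging

/-! ### Bounds on the independent bondage number -/

section Bondage

variable {V : Type*} {G : SimpleGraph V}

theorem exists_isIndepSet_isDominatingSet [Finite V] (G : SimpleGraph V) :
    ∃ D : Set V, G.IsIndepSet D ∧ G.IsDominatingSet D := by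
  obtain ⟨D, hD⟩ := (Set.toFinite {D : Set V | G.IsIndepSet D}).exists_maximal
    ⟨∅, by simp [IsIndepSet]⟩
  refine ⟨D, hD.prop, fun v => ?_⟩
  by_contra! hv
  have hins : G.IsIndepSet (insert v D) := by
    refine Set.Pairwise.insert hD.prop fun u hu _ => ⟨fun h => hv.2 u hu h.symm, hv.2 u hu⟩
  exact hv.1 (hD.le_of_ge hins (Set.subset_insert v D) (Set.mem_insert v D))

theorem indepDominationNumber_le {D : Set V} (hi : G.IsIndepSet D) (hd : G.IsDominatingSet D) :
    G.indepDominationNumber ≤ D.encard :=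
  iInf_le_of_le D (iInf_le_of_le hi (iInf_le _ hd))

/-- A set of edges bounds the independent bondage number if every independent dominating set that
arises from its deletion can be replaced by a smaller one of the original graph. -/
theorem indepBondageNumber_le_of_forall_exists [Finite V] {B : Set (Sym2 V)} (hB : B ⊆ G.edgeSet)
    (h : ∀ D : Set V, (G.deleteEdges B).IsIndepSet D → (G.deleteEdges B).IsDominatingSet D →
      ∃ D' : Set V, G.IsIndepSet D' ∧ G.IsDominatingSet D' ∧ D'.encard < D.encard) :
    G.indepBondageNumber ≤ B.encard := by
  refine iInf_le_of_le B (iInf_le_of_le hB (iInf_le _ ?_))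
  obtain ⟨D₀, hi₀, hd₀⟩ := exists_isIndepSet_isDominatingSet G
  have htop : G.indepDominationNumber ≠ ⊤ :=
    ne_top_of_le_ne_top (Set.toFinite D₀).encard_lt_top.ne (indepDominationNumber_le hi₀ hd₀)
  -- A strict bound need not survive an infimum, but `+ 1 ≤` does.
  rw [← ENat.add_one_le_iff htop]
  refine le_iInf fun D => le_iInf fun hi => le_iInf fun hd => ?_
  obtain ⟨D', hi', hd', hlt⟩ := h D hi hd
  rw [ENat.add_one_le_iff htop]
  exact (indepDominationNumber_le hi' hd').trans_lt hlt

theorem encard_diff_singleton_lt [Finite V] {D : Set V} {u : V} (hu : u ∈ D) :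
    (D \ {u}).encard < D.encard :=
  ((Set.toFinite _).subset Set.sdiff_subset).encard_lt_encard
    (Set.sdiff_singleton_ssubset.2 hu)

/-- The independent bondage number is less than the weight of every edge. -/
theorem indepBondageNumber_le_degree_add_degree [Fintype V] [DecidableRel G.Adj] {u v : V}
    (huv : G.Adj u v) : G.indepBondageNumber ≤ (G.degree u + G.degree v - 1 : ℕ) := by
  classical
  let B : Finset (Sym2 V) := G.incidenceFinset u ∪ (G.incidenceFinset v).erase s(u, v)
  have hmem : ∀ a b, s(a, b) ∈ B ↔ G.Adj a b ∧ (u = a ∨ u = b ∨ v = a ∨ v = b) := by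
    intro a b
    simp only [B, Finset.mem_union, Finset.mem_erase, mem_incidenceFinset, incidenceSet,
      Set.mem_ofPred_eq, mem_edgeSet, Sym2.mem_iff]
    constructor
    · tauto
    · rintro ⟨hab, h⟩
      by_cases he : s(a, b) = s(u, v)
      · rw [Sym2.eq_iff] at he
        have : u = a ∨ u = b := by tauto
        tauto
      · tauto
  have hcard : B.card ≤ G.degree u + G.degree v - 1 := by
    refine (Finset.card_union_le _ _).trans ?_
    have hin : s(u, v) ∈ G.incidenceFinset v := by
      simp [incidenceSet, huv]
    rw [Finset.card_erase_of_mem hin, card_incidenceFinset_eq_degree,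
      card_incidenceFinset_eq_degree]
    have : 0 < G.degree v := (G.degree_pos_iff_exists_adj v).2 ⟨u, huv.symm⟩
    omega
  refine (indepBondageNumber_le_of_forall_exists (B := (B : Set (Sym2 V))) ?_ ?_).trans ?_
  · intro e
    induction e with
    | _ a b => intro he; exact ((hmem a b).1 he).1
  · intro D hi hd
    have hadj : ∀ a b, (G.deleteEdges (B : Set (Sym2 V))).Adj a b ↔
        G.Adj a b ∧ ¬ (u = a ∨ u = b ∨ v = a ∨ v = b) := by
      intro a b
      rw [deleteEdges_adj, Finset.mem_coe, hmem]
      tauto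
    have huD : u ∈ D := by
      rcases hd u with h | ⟨w, -, hw⟩
      · exact h
      · rw [hadj] at hw; tauto
    have hvD : v ∈ D := by
      rcases hd v with h | ⟨w, -, hw⟩
      · exact h
      · rw [hadj] at hw; tauto
    have hind : ∀ a ∈ D, ∀ b ∈ D, G.Adj a b → u = a ∨ u = b ∨ v = a ∨ v = b := by
      intro a ha b hb hab
      by_contra h
      exact hi ha hb hab.ne ((hadj a b).2 ⟨hab, h⟩)
    have hdom : ∀ a, a ∈ D ∨ ∃ b ∈ D, G.Adj b a ∧ b ≠ u ∧ b ≠ v := by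
      intro a
      rcases hd a with h | ⟨w, hw, hwa⟩
      · exact Or.inl h
      · rw [hadj] at hwa
        exact Or.inr ⟨w, hw, hwa.1, fun h => hwa.2 (Or.inl h.symm),
          fun h => hwa.2 (Or.inr (Or.inr (Or.inl h.symm)))⟩
    have hne := huv.ne
    -- Removing one end of the edge keeps domination, the other end being there.
    have key : ∀ x y : V, G.Adj x y → x ∈ D → y ∈ D →
        (∀ a, a ∈ D ∨ ∃ b ∈ D, G.Adj b a ∧ b ≠ x ∧ b ≠ y) →
        (∀ a ∈ D, ∀ b ∈ D, G.Adj a b → x = a ∨ x = b ∨ y = a ∨ y = b) →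
        (∀ w ∈ D, G.Adj y w → w = x) →
        ∃ D' : Set V, G.IsIndepSet D' ∧ G.IsDominatingSet D' ∧ D'.encard < D.encard := by
      intro x y hxy hx hy hdom hind hyw
      refine ⟨D \ {x}, ?_, ?_, encard_diff_singleton_lt hx⟩
      · rintro a ⟨ha, hax⟩ b ⟨hb, hbx⟩ - hab
        simp only [Set.mem_singleton_iff] at hax hbx
        rcases hind a ha b hb hab with h | h | h | h
        · exact hax h.symm
        · exact hbx h.symm
        · subst h; exact hbx (hyw b hb hab)
        · subst h; exact hax (hyw a ha hab.symm)
      · intro a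
        by_cases hax : a = x
        · subst hax
          exact Or.inr ⟨y, ⟨hy, hxy.ne'⟩, hxy.symm⟩
        · rcases hdom a with h | ⟨b, hb, hba, hbx, -⟩
          · exact Or.inl ⟨h, hax⟩
          · exact Or.inr ⟨b, ⟨hb, hbx⟩, hba⟩
    by_cases hv : ∀ w ∈ D, G.Adj v w → w = u
    · exact key u v huv huD hvD hdom hind hv
    by_cases hu : ∀ w ∈ D, G.Adj u w → w = v
    · refine key v u huv.symm hvD huD ?_ ?_ hu
      · intro a
        rcases hdom a with h | ⟨b, h1, h2, h3, h4⟩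
        · exact Or.inl h
        · exact Or.inr ⟨b, h1, h2, h4, h3⟩
      · intro a ha b hb hab
        have := hind a ha b hb hab
        tauto
    -- Now `u` and `v` each have a neighbor in `D` besides the other, so both can go.
    push Not at hu hv
    obtain ⟨p, hpD, hp, hpv⟩ := hu
    obtain ⟨q, hqD, hq, hqu⟩ := hv
    refine ⟨D \ {u, v}, ?_, ?_, ?_⟩
    · rintro a ⟨ha, ha'⟩ b ⟨hb, hb'⟩ - hab
      simp only [Set.mem_insert_iff, Set.mem_singleton_iff, not_or] at ha' hb'
      rcases hind a ha b hb hab with h | h | h | h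
      · exact ha'.1 h.symm
      · exact hb'.1 h.symm
      · exact ha'.2 h.symm
      · exact hb'.2 h.symm
    · intro a
      by_cases hau : a = u
      · subst hau
        exact Or.inr ⟨p, ⟨hpD, by simp [hp.ne', hpv]⟩, hp.symm⟩
      by_cases hav : a = v
      · subst hav
        exact Or.inr ⟨q, ⟨hqD, by simp [hq.ne', hqu]⟩, hq.symm⟩
      rcases hdom a with h | ⟨b, hb, hba, hbu, hbv⟩
      · exact Or.inl ⟨h, by simp [hau, hav]⟩
      · exact Or.inr ⟨b, ⟨hb, by simp [hbu, hbv]⟩, hba⟩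
    · refine (Set.encard_le_encard ?_).trans_lt (encard_diff_singleton_lt huD)
      exact Set.sdiff_subset_sdiff_right (by simp)
  · rw [Set.encard_coe_eq_coe_finsetCard]
    exact_mod_cast hcard

/-- The independent bondage number is at most `4` if some vertex of degree `4` has only neighbors
of degree `2`. -/
theorem indepBondageNumber_le_four_of_degree_two_neighbors [Fintype V] [DecidableRel G.Adj] {v : V}
    (hv : G.degree v = 4) (h2 : ∀ u, G.Adj v u → G.degree u = 2) : G.indepBondageNumber ≤ 4 := by
  classical
  have hother : ∀ x, G.Adj v x → ∃ y, y ≠ v ∧ ∀ w, G.Adj x w ↔ w = v ∨ w = y := by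
    intro x hx
    have hmem : v ∈ G.neighborFinset x := by simpa using hx.symm
    have hc : ((G.neighborFinset x).erase v).card = 1 := by
      rw [Finset.card_erase_of_mem hmem, card_neighborFinset_eq_degree, h2 x hx]
    obtain ⟨y, hy⟩ := Finset.card_eq_one.1 hc
    have hyv : y ∈ (G.neighborFinset x).erase v := by simp [hy]
    refine ⟨y, Finset.ne_of_mem_erase hyv, fun w => ?_⟩
    rw [← mem_neighborFinset, ← Finset.insert_erase hmem, hy]
    simp
  have hcard : (G.neighborFinset v).card = 3 + 1 := by rw [card_neighborFinset_eq_degree, hv]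
  obtain ⟨x₄, s, hx₄, hs, hs3⟩ := Finset.card_eq_succ.1 hcard
  obtain ⟨x₁, x₂, x₃, h12, h13, h23, rfl⟩ := Finset.card_eq_three.1 hs3
  simp only [Finset.mem_insert, Finset.mem_singleton, not_or] at hx₄
  have hN : ∀ w, G.Adj v w ↔ w = x₄ ∨ w = x₁ ∨ w = x₂ ∨ w = x₃ := by
    intro w
    rw [← mem_neighborFinset, ← hs]
    simp
  have hv1 : G.Adj v x₁ := by simp [hN]
  have hv2 : G.Adj v x₂ := by simp [hN]
  have hv3 : G.Adj v x₃ := by simp [hN]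
  have hv4 : G.Adj v x₄ := by simp [hN]
  obtain ⟨y₁, hy1, hn1⟩ := hother x₁ hv1
  obtain ⟨y₂, hy2, hn2⟩ := hother x₂ hv2
  obtain ⟨y₃, hy3, hn3⟩ := hother x₃ hv3
  obtain ⟨y₄, -, hn4⟩ := hother x₄ hv4
  -- This isolates `x₁` and leaves `v` as the only neighbor of `x₂` and of `x₃`; `x₄` loses no edge
  -- to `v`.
  let B : Finset (Sym2 V) := {s(x₁, v), s(x₁, y₁), s(x₂, y₂), s(x₃, y₃)}
  refine (indepBondageNumber_le_of_forall_exists (B := (B : Set (Sym2 V))) ?_ ?_).trans ?_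
  · intro e he
    simp only [B, Finset.coe_insert, Finset.coe_singleton, Set.mem_insert_iff,
      Set.mem_singleton_iff] at he
    rcases he with rfl | rfl | rfl | rfl <;> simp [hn1, hn2, hn3]
  · intro D hi hd
    have hB : ∀ e, e ∈ (B : Set (Sym2 V)) ↔
        e = s(x₁, v) ∨ e = s(x₁, y₁) ∨ e = s(x₂, y₂) ∨ e = s(x₃, y₃) := by
      intro e
      simp [B]
    set H := G.deleteEdges (B : Set (Sym2 V))
    have hle : ∀ a b, H.Adj a b → G.Adj a b := fun a b h => (deleteEdges_adj.1 h).1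
    have hdel : ∀ a b, G.Adj a b → ¬ H.Adj a b →
        (a = x₁ ∨ a = x₂ ∨ a = x₃) ∨ (b = x₁ ∨ b = x₂ ∨ b = x₃) := by
      intro a b hab hn
      have : s(a, b) ∈ (B : Set (Sym2 V)) := by
        by_contra h
        exact hn (deleteEdges_adj.2 ⟨hab, h⟩)
      rw [hB] at this
      simp only [Sym2.eq_iff] at this
      tauto
    have hx1 : ∀ w, ¬ H.Adj w x₁ := by
      intro w hw
      have hw' := (hn1 w).1 (hle _ _ hw).symm
      have := (deleteEdges_adj.1 hw).2
      rw [hB] at this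
      rcases hw' with rfl | rfl <;> exact this (by simp [Sym2.eq_swap])
    have hx2 : ∀ w, H.Adj w x₂ → w = v := by
      intro w hw
      rcases (hn2 w).1 (hle _ _ hw).symm with h | rfl
      · exact h
      · have := (deleteEdges_adj.1 hw).2
        rw [hB] at this
        exact absurd (by simp [Sym2.eq_swap]) this
    have hx3 : ∀ w, H.Adj w x₃ → w = v := by
      intro w hw
      rcases (hn3 w).1 (hle _ _ hw).symm with h | rfl
      · exact h
      · have := (deleteEdges_adj.1 hw).2
        rw [hB] at this
        exact absurd (by simp [Sym2.eq_swap]) this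
    have hx1D : x₁ ∈ D := by
      rcases hd x₁ with h | ⟨w, -, hw⟩
      · exact h
      · exact absurd hw (hx1 w)
    by_cases hvD : v ∈ D
    · have hx2D : x₂ ∉ D := fun h => hi hvD h hv2.ne (deleteEdges_adj.2 ⟨hv2, by
        rw [hB]
        simp only [Sym2.eq_iff]
        have := hv1.ne
        have := hv2.ne
        have := hv3.ne
        tauto⟩)
      have hx3D : x₃ ∉ D := fun h => hi hvD h hv3.ne (deleteEdges_adj.2 ⟨hv3, by
        rw [hB]
        simp only [Sym2.eq_iff]
        have := hv1.ne
        have := hv2.ne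
        have := hv3.ne
        tauto⟩)
      refine ⟨D \ {x₁}, ?_, ?_, encard_diff_singleton_lt hx1D⟩
      · rintro a ⟨ha, ha'⟩ b ⟨hb, hb'⟩ hab hadj
        rw [Set.mem_singleton_iff] at ha' hb'
        rcases hdel a b hadj (hi ha hb hab) with (h | h | h) | (h | h | h)
        · exact ha' h
        · exact hx2D (h ▸ ha)
        · exact hx3D (h ▸ ha)
        · exact hb' h
        · exact hx2D (h ▸ hb)
        · exact hx3D (h ▸ hb)
      · intro a
        by_cases hax : a = x₁
        · exact Or.inr ⟨v, ⟨hvD, hv1.ne⟩, hax ▸ hv1⟩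
        · rcases hd a with h | ⟨w, hwD, hw⟩
          · exact Or.inl ⟨h, hax⟩
          · refine Or.inr ⟨w, ⟨hwD, fun h => ?_⟩, hle _ _ hw⟩
            rw [Set.mem_singleton_iff] at h
            subst h
            exact hx1 a hw.symm
    · have hx2D : x₂ ∈ D := by
        rcases hd x₂ with h | ⟨w, hwD, hw⟩
        · exact h
        · rw [hx2 w hw] at hwD; exact absurd hwD hvD
      have hx3D : x₃ ∈ D := by
        rcases hd x₃ with h | ⟨w, hwD, hw⟩
        · exact h
        · rw [hx3 w hw] at hwD; exact absurd hwD hvD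
      -- Exchange `D ∩ N(v)`, which contains `x₁`, `x₂`, `x₃`, for `v`. Only `y₄` may lose its
      -- dominator, namely `x₄`; it is then added.
      let C : Set V := D \ G.neighborSet v
      have hC : C.encard + 3 ≤ D.encard := by
        have hsub : insert x₁ (insert x₂ (insert x₃ C)) ⊆ D := by
          simp only [Set.insert_subset_iff]
          exact ⟨hx1D, hx2D, hx3D, Set.sdiff_subset⟩
        refine le_trans (le_of_eq ?_) (Set.encard_le_encard hsub)
        rw [Set.encard_insert_of_notMem, Set.encard_insert_of_notMem, Set.encard_insert_of_notMem,
          add_assoc, add_assoc]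
        · norm_num
        · exact fun h => h.2 hv3
        · rintro (h | h)
          · exact h23 h
          · exact h.2 hv2
        · rintro (h | h | h)
          · exact h12 h
          · exact h13 h
          · exact h.2 hv1
      have hfin : C.encard ≠ ⊤ := (Set.toFinite C).encard_lt_top.ne
      have hlt : C.encard + 2 < D.encard :=
        lt_of_lt_of_le ((ENat.add_lt_add_iff_left hfin).2 (by norm_num)) hC
      have hD1 : G.IsIndepSet (insert v C) := by
        refine Set.Pairwise.insert ?_ fun u hu _ => ⟨hu.2, fun h => hu.2 h.symm⟩
        rintro a ⟨ha, ha'⟩ b ⟨hb, hb'⟩ hab hadj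
        rw [mem_neighborSet, hN] at ha' hb'
        have := hdel a b hadj (hi ha hb hab)
        tauto
      have hdom : ∀ a, a ≠ y₄ → a ∈ insert v C ∨ ∃ w ∈ insert v C, G.Adj w a := by
        intro a hay
        by_cases hav : a = v
        · exact Or.inl (Or.inl hav)
        by_cases haN : G.Adj v a
        · exact Or.inr ⟨v, Or.inl rfl, haN⟩
        rcases hd a with h | ⟨w, hwD, hw⟩
        · exact Or.inl (Or.inr ⟨h, haN⟩)
        · refine Or.inr ⟨w, Or.inr ⟨hwD, fun hwN => ?_⟩, hle _ _ hw⟩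
          rcases (hN w).1 hwN with rfl | rfl | rfl | rfl
          · rcases (hn4 a).1 (hle _ _ hw) with h | h
            · exact hav h
            · exact hay h
          · exact hx1 a hw.symm
          · exact hav (hx2 a hw.symm)
          · exact hav (hx3 a hw.symm)
      by_cases hy : y₄ ∈ insert v C ∨ ∃ w ∈ insert v C, G.Adj w y₄
      · refine ⟨insert v C, hD1, fun a => ?_, ?_⟩
        · by_cases ha : a = y₄
          · exact ha ▸ hy
          · exact hdom a ha
        · refine (Set.encard_insert_le _ _).trans_lt (lt_of_le_of_lt ?_ hlt)
          gcongr
          norm_num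
      · push Not at hy
        refine ⟨insert y₄ (insert v C), ?_, fun a => ?_, ?_⟩
        · exact Set.Pairwise.insert hD1 fun u hu _ => ⟨fun h => hy.2 u hu h.symm, hy.2 u hu⟩
        · by_cases ha : a = y₄
          · exact Or.inl (Or.inl ha)
          · rcases hdom a ha with h | ⟨w, hw, hwa⟩
            · exact Or.inl (Or.inr h)
            · exact Or.inr ⟨w, Or.inr hw, hwa⟩
        · refine lt_of_le_of_lt ?_ hlt
          refine (Set.encard_insert_le _ _).trans ?_
          grw [Set.encard_insert_le]
          rw [add_assoc]
          norm_num
  · rw [Set.encard_coe_eq_coe_finsetCard]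
    exact_mod_cast Finset.card_le_four

end Bondage

end SimpleGraph

theorem mainTheorem4 {V : Type*} [Fintype V] (G : SimpleGraph V) [DecidableRel G.Adj]
    (hplanar : G.IsPlanar) (hdeg : 2 ≤ G.minDegree) (hgirth : 7 ≤ G.egirth) :
    G.indepBondageNumber ≤ 4 := by
  rcases hplanar.exists_light_configuration hdeg hgirth with ⟨u, v, huv, h⟩ | ⟨v, hv, h⟩
  · refine (indepBondageNumber_le_degree_add_degree huv).trans ?_
    exact_mod_cast (by omega : G.degree u + G.degree v - 1 ≤ 4)
  · exact indepBondageNumber_le_four_of_degree_two_neighbors hv h
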